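/- **Theorem.** Let $1<p\le 2$. For every $\alpha>0$ there is exactly one $\mu=\mu(\alpha)>0$ for which the problem $$-v''(x)=\mu\,\bigl(v(x)^p+v(x)\sin^2 v(x)\bigr),\quad v(x)>0\quad (0<x<1),\qquad v(0)=v(1)=0,$$ has a solution $v\in C^2([0,1])$ with $\|v\|_\infty=\alpha$. Moreover, as $\alpha\to\infty$: (i) if $1<p<2$, then $$\mu(\alpha)=2(p+1)\alpha^{1-p}\Bigl\{C_{0,p}+\bigl(C_1+\tfrac12C_{11}\bigr)\alpha^{1-p}+(C_2+C_3)\alpha^{2(1-p)}+o(\alpha^{2(1-p)})\Bigr\}^2;$$ (ii) if $p=2$, then $$\mu(\alpha)=6\alpha^{-1}\Bigl\{C_{0,2}+\bigl(C_1+\tfrac12C_{11}\bigr)\alpha^{-1}+\bigl(\tfrac12C_{12}+\tfrac12C_{21}+C_2+C_3\bigr)\alpha^{-2}+o(\alpha^{-2})\Bigr\}^2.$$ Here $C_{0,p},C_1,C_2$ depend only on $p$, while $C_{11},C_{12},C_{21},C_3$ depend on $p$ and $\alpha$: $$C_{0,p}=\int_0^1\frac{ds}{\sqrt{1-s^{p+1}}},\qquad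 C_1=-\frac{p+1}{8}\int_0^1\frac{1-s^2}{(1-s^{p+1})^{3/2}}\,ds,\qquad C_2=\frac{3(p+1)^2}{128}\int_0^1\frac{(1-s^2)^2}{(1-s^{p+1})^{5/2}}\,ds,$$ $$C_{11}=\frac{2}{p+1}\int_0^{\pi/2}\cos\bigl(2\alpha\sin^{2/(p+1)}\theta\bigr)\sin^{(3-p)/(p+1)}\theta\,d\theta,$$ $$C_{12}=\frac{p-1}{2(p+1)}\int_0^{\pi/2}\bigl(\sin2\alpha-\sin(2\alpha\sin^{2/(p+1)}\theta)\bigr)\sin^{(1-p)/(p+1)}\theta\,d\theta+\frac{p+1}{4}\int_0^1\frac{1-s}{(1-s^{p+1})^{3/2}}\sin(2\alpha s)\,ds,$$ $$C_{21}=-\frac{1}{p+1}\int_0^{\pi/2}\sin\bigl(2\alpha\sin^{2/(p+1)}\theta\bigr)\sin^{(3-p)/(p+1)}\theta\,d\theta,$$ $$C_3=-\frac{3}{32}(p+1)^2\int_0^1\left(\int_0^s\frac{1-y^2}{(1-y^{p+1})^{5/2}}\,dy\right)\cos(2\alpha s)\,ds.$$ -/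

import Mathlib

open Real Set Filter Topology MeasureTheory Asymptotics

namespace OscBif

noncomputable section

/-- `v` is a positive `C²([0,1])` solution of
`-v'' = μ (v^p + v sin² v)` on `(0,1)` with `v(0) = v(1) = 0`.
(The two-sided derivatives are taken only at interior points, where `v` is `C²`.) -/
structure IsSolution (p μ : ℝ) (v : ℝ → ℝ) : Prop where
  contDiffOn : ContDiffOn ℝ 2 v (Icc 0 1)
  ode : ∀ x ∈ Ioo (0 : ℝ) 1,
    -deriv (deriv v) x = μ * ((v x) ^ p + v x * (sin (v x)) ^ 2)
  pos : ∀ x ∈ Ioo (0 : ℝ) 1, 0 < v x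
  left : v 0 = 0
  right : v 1 = 0

/-- `μ > 0` is a parameter for which the problem has a solution `v` with
sup norm `‖v‖_∞ = α`. -/
def IsBifurcationValue (p α μ : ℝ) : Prop :=
  0 < μ ∧ ∃ v : ℝ → ℝ, IsSolution p μ v ∧ IsLUB ((fun x => |v x|) '' Icc (0 : ℝ) 1) α

def C0 (p : ℝ) : ℝ := ∫ s in (0 : ℝ)..1, 1 / √(1 - s ^ (p + 1))

def C1 (p : ℝ) : ℝ :=
  -((p + 1) / 8) * ∫ s in (0 : ℝ)..1, (1 - s ^ 2) / (1 - s ^ (p + 1)) ^ (3 / 2 : ℝ)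

/-- Depends on `α`, through an oscillating integrand; likewise `C12`, `C21`, `C3`. -/
def C11 (p α : ℝ) : ℝ :=
  2 / (p + 1) * ∫ θ in (0 : ℝ)..(π / 2),
    cos (2 * α * sin θ ^ (2 / (p + 1))) * sin θ ^ ((3 - p) / (p + 1))

def C12 (p α : ℝ) : ℝ :=
  (p - 1) / (2 * (p + 1)) * (∫ θ in (0 : ℝ)..(π / 2),
    (sin (2 * α) - sin (2 * α * sin θ ^ (2 / (p + 1)))) * sin θ ^ ((1 - p) / (p + 1)))
  + (p + 1) / 4 * ∫ s in (0 : ℝ)..1,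
    (1 - s) / (1 - s ^ (p + 1)) ^ (3 / 2 : ℝ) * sin (2 * α * s)

def C21 (p α : ℝ) : ℝ :=
  -(1 / (p + 1)) * ∫ θ in (0 : ℝ)..(π / 2),
    sin (2 * α * sin θ ^ (2 / (p + 1))) * sin θ ^ ((3 - p) / (p + 1))

def C2 (p : ℝ) : ℝ :=
  3 * (p + 1) ^ 2 / 128 *
    ∫ s in (0 : ℝ)..1, (1 - s ^ 2) ^ 2 / (1 - s ^ (p + 1)) ^ (5 / 2 : ℝ)

def C3 (p α : ℝ) : ℝ :=
  -(3 / 32) * (p + 1) ^ 2 * ∫ s in (0 : ℝ)..1,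
    (∫ y in (0 : ℝ)..s, (1 - y ^ 2) / (1 - y ^ (p + 1)) ^ (5 / 2 : ℝ)) * cos (2 * α * s)

end

end OscBif

/-!
Multiplying `-v'' = μ f(v)`, `f(u) = u ^ p + u sin² u`, by `v'` gives the energy identity
`v'² = 2 μ (F(α) - F(v))` with `F' = f`. A solution increases to its maximum `α` at `x = 1 / 2`, so
`√(2 μ) / 2 = ∫₀^α du / √(F(α) - F(u))`, which determines `μ`. Conversely, with `v = α sin θ` the
energy identity becomes an equation `θ' = ω(θ)` whose positive speed `ω` stays regular at the
turning points; it is solved by inverting `∫ dθ / ω`.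

After `u = α s`, `√μ` is `√(2 (p + 1) α ^ (1 - p))` times the integral over `s ∈ (0, 1)` of
`(h(s) + (p + 1) α ^ (1 - p) k(s)) ^ (-1 / 2)`, where `h(s) = 1 - s ^ (p + 1)` and `k` comes from
`u sin² u`. As `0 ≤ k ≤ h / 2`, the Taylor expansion of `x ↦ x ^ (-1 / 2)` at `h` integrates with a
remainder `O(α ^ (3 (1 - p)))`. In the first-order term `∫ k / h ^ (3 / 2)`, integration by parts
against `s / √h` produces `C₁₁`, `C₁₂` and `C₂₁`. In the second-order term the oscillation of `k`
disappears as `α → ∞`, leaving `C₂`, while `C₃ → 0` by the Riemann–Lebesgue lemma.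
-/

namespace OscBif

section Uniqueness

/-- `v` is a positive solution, `C²` up to the boundary, of the autonomous Dirichlet problem
`-v'' = μ f(v)` on `(0, 1)`, `v(0) = v(1) = 0`. -/
structure IsDirichletSolution (f : ℝ → ℝ) (μ : ℝ) (v : ℝ → ℝ) : Prop where
  contDiffOn : ContDiffOn ℝ 2 v (Icc 0 1)
  ode : ∀ x ∈ Ioo (0 : ℝ) 1, -deriv (deriv v) x = μ * f (v x)
  pos : ∀ x ∈ Ioo (0 : ℝ) 1, 0 < v x
  left : v 0 = 0
  right : v 1 = 0

/-- The time map of `-v'' = f(v)`, `F' = f`: up to the factor `√2`, the time an orbit of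
amplitude `α` takes to climb from `0` to its maximum. -/
noncomputable def timeMap (F : ℝ → ℝ) (α : ℝ) : ℝ :=
  ∫ u in (0 : ℝ)..α, 1 / √(F α - F u)

namespace IsDirichletSolution

variable {f F v : ℝ → ℝ} {μ α c x y : ℝ}

theorem hasDerivAt (hv : IsDirichletSolution f μ v) (hx : x ∈ Ioo (0 : ℝ) 1) :
    HasDerivAt v (deriv v x) x :=
  ((hv.contDiffOn.contDiffAt (Icc_mem_nhds hx.1 hx.2)).differentiableAt two_ne_zero).hasDerivAt

theorem hasDerivAt_deriv (hv : IsDirichletSolution f μ v) (hx : x ∈ Ioo (0 : ℝ) 1) :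
    HasDerivAt (deriv v) (-(μ * f (v x))) x := by
  have hC1 : ContDiffOn ℝ 1 (deriv v) (Ioo 0 1) :=
    (contDiffOn_succ_iff_deriv_of_isOpen isOpen_Ioo).1
      (hv.contDiffOn.mono Ioo_subset_Icc_self : ContDiffOn ℝ (1 + 1) v (Ioo 0 1)) |>.2.2
  rw [← hv.ode x hx, neg_neg]
  exact ((hC1.contDiffAt (isOpen_Ioo.mem_nhds hx)).differentiableAt one_ne_zero).hasDerivAt

theorem energy_eq (hF : ∀ u > 0, HasDerivAt F (f u) u) (hv : IsDirichletSolution f μ v)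
    (hx : x ∈ Ioo (0 : ℝ) 1) (hy : y ∈ Ioo (0 : ℝ) 1) :
    deriv v x ^ 2 + 2 * μ * F (v x) = deriv v y ^ 2 + 2 * μ * F (v y) := by
  have hderiv : ∀ z ∈ Ioo (0 : ℝ) 1,
      HasDerivAt (fun z => deriv v z ^ 2 + 2 * μ * F (v z)) 0 z := fun z hz => by
    have hFv := (hF (v z) (hv.pos z hz)).comp z (hv.hasDerivAt hz)
    exact (((hv.hasDerivAt_deriv hz).pow 2).add (hFv.const_mul (2 * μ))).congr_deriv
      (by push_cast; ring)
  exact isOpen_Ioo.is_const_of_deriv_eq_zero isPreconnected_Ioo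
    (fun z hz => (hderiv z hz).differentiableAt.differentiableWithinAt)
    (fun z hz => (hderiv z hz).deriv) hx hy

theorem strictAntiOn_deriv (hμ : 0 < μ) (hf : ∀ u > 0, 0 < f u) (hv : IsDirichletSolution f μ v) :
    StrictAntiOn (deriv v) (Ioo 0 1) := by
  refine strictAntiOn_of_deriv_neg (convex_Ioo 0 1)
    (fun x hx => (hv.hasDerivAt_deriv hx).continuousAt.continuousWithinAt) fun x hx => ?_
  rw [interior_Ioo] at hx
  rw [(hv.hasDerivAt_deriv hx).deriv]
  exact neg_neg_of_pos (mul_pos hμ (hf _ (hv.pos x hx)))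

theorem timeMap_critical (hμ : 0 < μ) (hf : ∀ u > 0, 0 < f u)
    (hF : ∀ u > 0, HasDerivAt F (f u) u) (hv : IsDirichletSolution f μ v)
    (hc : c ∈ Ioo (0 : ℝ) 1) (hvc : deriv v c = 0) : timeMap F (v c) = √(2 * μ) * c := by
  have hIoo : ∀ x ∈ Ioo 0 c, x ∈ Ioo (0 : ℝ) 1 := fun x hx => ⟨hx.1, hx.2.trans hc.2⟩
  have hpos : ∀ x ∈ Ioo 0 c, 0 < deriv v x := fun x hx => by
    rw [← hvc]
    exact hv.strictAntiOn_deriv hμ hf (hIoo x hx) hc hx.2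
  have hspeed : ∀ x ∈ Ioo 0 c, deriv v x = √(2 * μ) * √(F (v c) - F (v x)) := fun x hx => by
    rw [← Real.sqrt_mul (by positivity), ← Real.sqrt_sq (hpos x hx).le]
    congr 1
    have := hv.energy_eq hF (hIoo x hx) hc
    rw [hvc] at this
    linarith
  calc timeMap F (v c)
      = ∫ x in (0 : ℝ)..c, ((fun u => 1 / √(F (v c) - F u)) ∘ v) x * deriv v x := by
        rw [intervalIntegral.integral_comp_mul_deriv_of_deriv_nonneg, hv.left, timeMap]
        · rw [uIcc_of_le hc.1.le]
          exact hv.contDiffOn.continuousOn.mono (Icc_subset_Icc_right hc.2.le)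
        all_goals rw [min_eq_left hc.1.le, max_eq_right hc.1.le]
        · exact fun x hx => hv.hasDerivAt (hIoo x hx)
        · exact fun x hx => (hpos x hx).le
    _ = ∫ _ in (0 : ℝ)..c, √(2 * μ) := by
        refine intervalIntegral.integral_congr_Ioo_of_le hc.1.le fun x hx => ?_
        have hne : √(2 * μ) * √(F (v c) - F (v x)) ≠ 0 := hspeed x hx ▸ (hpos x hx).ne'
        simp only [Function.comp, hspeed x hx]
        rw [one_div_mul_eq_div, mul_div_cancel_right₀ _ (right_ne_zero_of_mul hne)]
    _ = √(2 * μ) * c := by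
        rw [intervalIntegral.integral_const, sub_zero, smul_eq_mul, mul_comm]

theorem reflect (hv : IsDirichletSolution f μ v) :
    IsDirichletSolution f μ (fun x => v (1 - x)) where
  contDiffOn := hv.contDiffOn.comp (contDiff_const.sub contDiff_id).contDiffOn
    fun x hx => ⟨sub_nonneg.2 hx.2, sub_le_self 1 hx.1⟩
  ode x hx := by
    have : deriv (fun x => v (1 - x)) = fun x => -deriv v (1 - x) :=
      funext fun x => deriv_comp_const_sub v 1 x
    rw [this, deriv.fun_neg, deriv_comp_const_sub, neg_neg]
    exact hv.ode (1 - x) ⟨sub_pos.2 hx.2, sub_lt_self 1 hx.1⟩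
  pos x hx := hv.pos (1 - x) ⟨sub_pos.2 hx.2, sub_lt_self 1 hx.1⟩
  left := by simpa using hv.right
  right := by simpa using hv.left

theorem exists_critical (hv : IsDirichletSolution f μ v)
    (hα : IsLUB ((fun x => |v x|) '' Icc (0 : ℝ) 1) α) :
    ∃ c ∈ Ioo (0 : ℝ) 1, v c = α ∧ deriv v c = 0 := by
  have hnonneg : ∀ x ∈ Icc (0 : ℝ) 1, 0 ≤ v x := fun x hx => by
    rcases hx.1.eq_or_lt with rfl | h0
    · exact hv.left.ge
    rcases hx.2.eq_or_lt with rfl | h1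
    · exact hv.right.ge
    · exact (hv.pos x ⟨h0, h1⟩).le
  obtain ⟨c, hcI, hmax⟩ := isCompact_Icc.exists_isMaxOn (nonempty_Icc.2 zero_le_one)
    hv.contDiffOn.continuousOn
  have hvc : 0 < v c :=
    (hv.pos (1 / 2) (by norm_num)).trans_le (hmax (show (1 / 2 : ℝ) ∈ Icc 0 1 by norm_num))
  have hc : c ∈ Ioo (0 : ℝ) 1 := by
    refine ⟨hcI.1.lt_of_ne ?_, hcI.2.lt_of_ne ?_⟩ <;> rintro rfl
    exacts [hvc.ne' hv.left, hvc.ne' hv.right]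
  refine ⟨c, hc, le_antisymm ((le_abs_self _).trans (hα.1 ⟨c, hcI, rfl⟩)) (hα.2 ?_),
    (hmax.isLocalMax (Icc_mem_nhds hc.1 hc.2)).deriv_eq_zero⟩
  rintro _ ⟨x, hx, rfl⟩
  exact (abs_of_nonneg (hnonneg x hx)).trans_le (hmax hx)

theorem eq_timeMap_sq (hμ : 0 < μ) (hf : ∀ u > 0, 0 < f u)
    (hF : ∀ u > 0, HasDerivAt F (f u) u) (hv : IsDirichletSolution f μ v)
    (hα : IsLUB ((fun x => |v x|) '' Icc (0 : ℝ) 1) α) : μ = 2 * timeMap F α ^ 2 := by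
  obtain ⟨c, hc, rfl, hdc⟩ := hv.exists_critical hα
  have hrise := hv.timeMap_critical hμ hf hF hc hdc
  have hfall := hv.reflect.timeMap_critical (c := 1 - c) hμ hf hF
    ⟨sub_pos.2 hc.2, sub_lt_self 1 hc.1⟩
    (by rw [deriv_comp_const_sub, sub_sub_cancel, hdc, neg_zero])
  rw [sub_sub_cancel] at hfall
  have hsum : 2 * timeMap F (v c) = √(2 * μ) := by linarith
  have hsq : (2 * timeMap F (v c)) ^ 2 = 2 * μ := by rw [hsum, Real.sq_sqrt (by positivity)]
  linarith

end IsDirichletSolution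

end Uniqueness

section Existence

theorem hasDerivAt_mul_of_eq_zero {f g : ℝ → ℝ} {f' x : ℝ} (hf : HasDerivAt f f' x)
    (hg : ContinuousAt g x) (hfx : f x = 0) : HasDerivAt (fun y => f y * g y) (f' * g x) x := by
  rw [hasDerivAt_iff_tendsto_slope] at hf ⊢
  refine (hf.mul (hg.tendsto.mono_left nhdsWithin_le_nhds)).congr fun y => ?_
  simp only [slope_def_field, hfx]
  ring

theorem hasDerivAt_of_hasDerivAt_sq {f : ℝ → ℝ} {f' x : ℝ}
    (hsq : HasDerivAt (fun y => f y ^ 2) (2 * f x * f') x) (hf : ContinuousAt f x)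
    (hfx : f x ≠ 0) : HasDerivAt f f' x := by
  rw [hasDerivAt_iff_tendsto_slope] at hsq ⊢
  have hadd : Tendsto (fun y => f y + f x) (𝓝[≠] x) (𝓝 (2 * f x)) := by
    rw [two_mul]
    exact (hf.tendsto.mono_left nhdsWithin_le_nhds).add_const _
  have hne : 2 * f x ≠ 0 := mul_ne_zero two_ne_zero hfx
  have hquot := hsq.div hadd hne
  rw [mul_div_cancel_left₀ _ hne] at hquot
  refine hquot.congr' ?_
  filter_upwards [hadd.eventually_ne hne] with y hy
  simp only [slope_def_field, Pi.div_apply]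
  rw [div_right_comm, sq_sub_sq, mul_div_cancel_left₀ _ hy]

theorem contDiff_two_of_hasDerivAt {f f' f'' : ℝ → ℝ} (hf : ∀ x, HasDerivAt f (f' x) x)
    (hf' : ∀ x, HasDerivAt f' (f'' x) x) (hf'' : Continuous f'') : ContDiff ℝ 2 f := by
  have hderiv : deriv f = f' := funext fun x => (hf x).deriv
  have hderiv' : deriv f' = f'' := funext fun x => (hf' x).deriv
  rw [← one_add_one_eq_two, contDiff_succ_iff_deriv, hderiv, contDiff_one_iff_deriv, hderiv']
  exact ⟨fun x => (hf x).differentiableAt, by simp, fun x => (hf' x).differentiableAt, hf''⟩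

theorem exists_hasDerivAt_comp_of_periodic {s : ℝ → ℝ} {T : ℝ} (hs : Continuous s)
    (hpos : ∀ φ, 0 < s φ) (hper : Function.Periodic s T) (hT : 0 < T) :
    ∃ L > 0, ∃ θ : ℝ → ℝ, StrictMono θ ∧ θ 0 = 0 ∧ θ 1 = T ∧
      ∀ x, HasDerivAt θ (L * s (θ x)) x := by
  have hcont : Continuous fun φ => (s φ)⁻¹ := hs.inv₀ fun φ => (hpos φ).ne'
  have hinv : ∀ φ, 0 < (s φ)⁻¹ := fun φ => inv_pos.2 (hpos φ)
  have hper' : Function.Periodic (fun φ => (s φ)⁻¹) T := fun φ => by simp only [hper φ]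
  set L : ℝ := ∫ φ in (0 : ℝ)..T, (s φ)⁻¹
  have hL : 0 < L :=
    intervalIntegral.intervalIntegral_pos_of_pos (hcont.intervalIntegrable 0 T) hinv hT
  let τ : ℝ → ℝ := fun φ => (∫ t in (0 : ℝ)..φ, (s t)⁻¹) / L
  have hτ : ∀ φ, HasDerivAt τ ((s φ)⁻¹ / L) φ := fun φ =>
    (hcont.integral_hasStrictDerivAt 0 φ).hasDerivAt.div_const L
  have hmono : StrictMono τ := strictMono_of_hasDerivAt_pos hτ fun φ => div_pos (hinv φ) hL
  have hsurj : Function.Surjective τ :=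
    (continuous_iff_continuousAt.2 fun φ => (hτ φ).continuousAt).surjective
      ((hper'.tendsto_atTop_intervalIntegral_of_pos' (hcont.intervalIntegrable 0 T)
        hinv hT).atTop_div_const hL)
      ((hper'.tendsto_atBot_intervalIntegral_of_pos' (hcont.intervalIntegrable 0 T)
        hinv hT).atBot_div_const hL)
  let e : ℝ ≃o ℝ := hmono.orderIsoOfSurjective τ hsurj
  refine ⟨L, hL, e.symm, e.symm.strictMono, ?_, ?_, fun x => ?_⟩
  · exact e.symm_apply_eq.2 (by simp [e, τ])
  · exact e.symm_apply_eq.2 (div_self hL.ne').symm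
  · have hderiv := HasDerivAt.of_local_left_inverse e.symm.continuous.continuousAt
      (hτ (e.symm x)) (div_pos (hinv _) hL).ne' (Eventually.of_forall e.apply_symm_apply)
    rwa [inv_div, div_inv_eq_mul] at hderiv

/-- The angular speed `θ' = orbitSpeed g α θ` along the orbit `u = α sin θ` of amplitude `α` of
`u'' = -u g(u²)`; conservation of energy reads
`(α cos θ · orbitSpeed g α θ)² = ∫ w in (α sin θ)²..α², g w`. -/
noncomputable def orbitSpeed (g : ℝ → ℝ) (α φ : ℝ) : ℝ :=
  √(∫ t in (0 : ℝ)..1, g (α ^ 2 * (1 - t * cos φ ^ 2)))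

variable {g : ℝ → ℝ} {α : ℝ}

theorem orbitSpeed_periodic (g : ℝ → ℝ) (α : ℝ) : Function.Periodic (orbitSpeed g α) π :=
  fun φ => by simp only [orbitSpeed, cos_add_pi, neg_sq]

theorem continuous_orbitSpeed (hg : Continuous g) : Continuous (orbitSpeed g α) :=
  (intervalIntegral.continuous_parametric_intervalIntegral_of_continuous'
    (by fun_prop) 0 1).sqrt

theorem integral_comp_sq_cos_pos (hg : Continuous g) (hpos : ∀ w > 0, 0 < g w) (hα : 0 < α)
    (φ : ℝ) : 0 < ∫ t in (0 : ℝ)..1, g (α ^ 2 * (1 - t * cos φ ^ 2)) := by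
  refine intervalIntegral.intervalIntegral_pos_of_pos_on
    (Continuous.intervalIntegrable (by fun_prop) 0 1) (fun t ht => hpos _ ?_) zero_lt_one
  have : t * cos φ ^ 2 < 1 := (mul_le_of_le_one_right ht.1.le (cos_sq_le_one φ)).trans_lt ht.2
  exact mul_pos (pow_pos hα 2) (sub_pos.2 this)

theorem orbitSpeed_pos (hg : Continuous g) (hpos : ∀ w > 0, 0 < g w) (hα : 0 < α) (φ : ℝ) :
    0 < orbitSpeed g α φ :=
  Real.sqrt_pos.2 (integral_comp_sq_cos_pos hg hpos hα φ)

theorem sq_cos_mul_orbitSpeed (hg : Continuous g) (hpos : ∀ w > 0, 0 < g w) (hα : 0 < α) (φ : ℝ) :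
    (α * cos φ * orbitSpeed g α φ) ^ 2 = ∫ w in (α * sin φ) ^ 2..α ^ 2, g w := by
  have hscale := intervalIntegral.mul_integral_comp_sub_mul (a := 0) (b := 1) (f := g)
    (c := (α * cos φ) ^ 2) (d := α ^ 2)
  rw [mul_pow, orbitSpeed, Real.sq_sqrt (integral_comp_sq_cos_pos hg hpos hα φ).le]
  convert hscale using 2
  · exact intervalIntegral.integral_congr fun t _ => congrArg g (by ring)
  · rw [mul_pow, mul_pow, sin_sq]; ring
  · ring

theorem orbitSpeed_sq_of_cos_eq_zero (hg : Continuous g) (hpos : ∀ w > 0, 0 < g w) (hα : 0 < α)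
    {φ : ℝ} (hφ : cos φ = 0) : orbitSpeed g α φ ^ 2 = g (α ^ 2) := by
  rw [orbitSpeed, Real.sq_sqrt (integral_comp_sq_cos_pos hg hpos hα φ).le]
  simp [hφ]

theorem hasDerivAt_cos_mul_orbitSpeed (hg : Continuous g) (hpos : ∀ w > 0, 0 < g w) (hα : 0 < α)
    (φ : ℝ) : HasDerivAt (fun φ => α * cos φ * orbitSpeed g α φ)
      (-(α * sin φ * g ((α * sin φ) ^ 2)) / orbitSpeed g α φ) φ := by
  have hs := orbitSpeed_pos hg hpos hα φ
  by_cases hφ : cos φ = 0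
  · -- At a turning point the square root is not differentiable, but its cofactor vanishes.
    refine (hasDerivAt_mul_of_eq_zero ((hasDerivAt_cos φ).const_mul α)
      (continuous_orbitSpeed hg).continuousAt (by rw [hφ, mul_zero])).congr_deriv ?_
    rw [eq_div_iff hs.ne', mul_assoc, ← sq, orbitSpeed_sq_of_cos_eq_zero hg hpos hα hφ, mul_pow,
      sin_sq, hφ]
    ring_nf
  · have henergy : HasDerivAt (fun φ => ∫ w in (α * sin φ) ^ 2..α ^ 2, g w)
        (-g ((α * sin φ) ^ 2) * (2 * (α * sin φ) * (α * cos φ))) φ := by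
      refine HasDerivAt.congr_deriv (HasDerivAt.comp φ (intervalIntegral.integral_hasDerivAt_left
        (hg.intervalIntegrable _ _) (hg.stronglyMeasurableAtFilter _ _) hg.continuousAt)
        (((hasDerivAt_sin φ).const_mul α).pow 2)) (by push_cast; ring)
    simp only [← sq_cos_mul_orbitSpeed hg hpos hα] at henergy
    refine hasDerivAt_of_hasDerivAt_sq (henergy.congr_deriv ?_) ?_
      (mul_ne_zero (mul_ne_zero hα.ne' hφ) hs.ne')
    · field_simp
    · exact ((continuous_const.mul continuous_cos).mul (continuous_orbitSpeed hg)).continuousAt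

theorem exists_isDirichletSolution {f : ℝ → ℝ} (hg : Continuous g) (hpos : ∀ w > 0, 0 < g w)
    (hf : ∀ u > 0, f u = u * g (u ^ 2)) (hα : 0 < α) :
    ∃ μ > 0, ∃ v, IsDirichletSolution f μ v ∧ IsLUB ((fun x => |v x|) '' Icc (0 : ℝ) 1) α := by
  obtain ⟨L, hL, θ, hmono, hθ0, hθ1, hθ⟩ :=
    exists_hasDerivAt_comp_of_periodic (continuous_orbitSpeed (α := α) hg)
      (orbitSpeed_pos hg hpos hα) (orbitSpeed_periodic g α) pi_pos
  have hθc : Continuous θ := continuous_iff_continuousAt.2 fun x => (hθ x).continuousAt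
  set v : ℝ → ℝ := fun x => α * sin (θ x)
  have hv : ∀ x, HasDerivAt v (L * (α * cos (θ x) * orbitSpeed g α (θ x))) x := fun x =>
    ((hθ x).sin.const_mul α).congr_deriv (by ring)
  have hv' : ∀ x, HasDerivAt (fun x => L * (α * cos (θ x) * orbitSpeed g α (θ x)))
      (-(L ^ 2 * (v x * g (v x ^ 2)))) x := fun x => by
    refine (((hasDerivAt_cos_mul_orbitSpeed hg hpos hα (θ x)).comp x (hθ x)).const_mul
      L).congr_deriv ?_
    change L * (-(v x * g (v x ^ 2)) / orbitSpeed g α (θ x) * (L * orbitSpeed g α (θ x))) = _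
    have := (orbitSpeed_pos hg hpos hα (θ x)).ne'
    field_simp
  have hvpos : ∀ x ∈ Ioo (0 : ℝ) 1, 0 < v x := fun x hx =>
    mul_pos hα (sin_pos_of_mem_Ioo ⟨hθ0 ▸ hmono hx.1, hθ1 ▸ hmono hx.2⟩)
  refine ⟨L ^ 2, pow_pos hL 2, v, ⟨?_, fun x hx => ?_, hvpos, ?_, ?_⟩, IsGreatest.isLUB ⟨?_, ?_⟩⟩
  · exact (contDiff_two_of_hasDerivAt hv hv' (by fun_prop)).contDiffOn
  · rw [show deriv v = _ from funext fun x => (hv x).deriv, (hv' x).deriv, neg_neg,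
      hf _ (hvpos x hx)]
  · simp [v, hθ0]
  · simp [v, hθ1]
  · obtain ⟨x, hx, hθx⟩ : π / 2 ∈ θ '' Icc 0 1 :=
      intermediate_value_Icc zero_le_one hθc.continuousOn
        (by rw [hθ0, hθ1]; constructor <;> linarith [pi_pos])
    exact ⟨x, hx, by simp [v, hθx, abs_of_pos hα]⟩
  · rintro _ ⟨x, -, rfl⟩
    simp only [v, abs_mul, abs_of_pos hα]
    exact mul_le_of_le_one_right hα.le (abs_sin_le_one _)

end Existence

section BifurcationValue

variable {p α μ : ℝ} {v : ℝ → ℝ}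

/-- The right-hand side `u ^ p + u sin² u` of the equation. -/
noncomputable def nonlinearity (p u : ℝ) : ℝ := u ^ p + u * sin u ^ 2

/-- The primitive of `nonlinearity p` vanishing at `0`, for `0 ≤ u`. -/
noncomputable def potential (p u : ℝ) : ℝ :=
  u ^ (p + 1) / (p + 1) + ∫ t in (0 : ℝ)..u, t * sin t ^ 2

theorem nonlinearity_pos (p : ℝ) {u : ℝ} (hu : 0 < u) : 0 < nonlinearity p u := by
  have := rpow_pos_of_pos hu p
  unfold nonlinearity
  positivity

theorem nonlinearity_eq_mul (p : ℝ) {u : ℝ} (hu : 0 < u) :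
    nonlinearity p u = u * (√(u ^ 2) ^ (p - 1) + sin √(u ^ 2) ^ 2) := by
  rw [Real.sqrt_sq hu.le, nonlinearity, mul_add, Real.rpow_sub_one hu.ne', mul_div_cancel₀ _ hu.ne']

theorem hasDerivAt_potential (hp : p + 1 ≠ 0) {u : ℝ} (hu : 0 < u) :
    HasDerivAt (potential p) (nonlinearity p u) u := by
  have hpow := (Real.hasDerivAt_rpow_const (p := p + 1) (Or.inl hu.ne')).div_const (p + 1)
  have hosc : Continuous fun t : ℝ => t * sin t ^ 2 := by fun_prop
  refine (hpow.add (hosc.integral_hasStrictDerivAt 0 u).hasDerivAt).congr_deriv ?_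
  rw [add_sub_cancel_right, mul_div_cancel_left₀ _ hp, nonlinearity]

theorem isSolution_iff_isDirichletSolution :
    IsSolution p μ v ↔ IsDirichletSolution (nonlinearity p) μ v :=
  ⟨fun h => ⟨h.contDiffOn, h.ode, h.pos, h.left, h.right⟩,
    fun h => ⟨h.contDiffOn, h.ode, h.pos, h.left, h.right⟩⟩

theorem IsBifurcationValue.eq_timeMap_sq (hp : p + 1 ≠ 0) (h : IsBifurcationValue p α μ) :
    μ = 2 * timeMap (potential p) α ^ 2 := by
  obtain ⟨hμ, v, hv, hα⟩ := h
  exact (isSolution_iff_isDirichletSolution.1 hv).eq_timeMap_sq hμ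
    (fun _ => nonlinearity_pos p) (fun _ => hasDerivAt_potential hp) hα

theorem existsUnique_isBifurcationValue (hp : 1 ≤ p) (hα : 0 < α) :
    ∃! μ, IsBifurcationValue p α μ := by
  have hcont : Continuous fun w : ℝ => √w ^ (p - 1) + sin √w ^ 2 :=
    (Real.continuous_sqrt.rpow_const fun _ => Or.inr (by linarith)).add (by fun_prop)
  have hpos : ∀ w > 0, 0 < √w ^ (p - 1) + sin √w ^ 2 := fun w hw =>
    add_pos_of_pos_of_nonneg (rpow_pos_of_pos (Real.sqrt_pos.2 hw) _) (sq_nonneg _)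
  obtain ⟨μ, hμ, v, hv, hlub⟩ := exists_isDirichletSolution hcont hpos
    (fun _ => nonlinearity_eq_mul p) hα
  have hbif : IsBifurcationValue p α μ := ⟨hμ, v, isSolution_iff_isDirichletSolution.2 hv, hlub⟩
  have hp' : p + 1 ≠ 0 := by linarith
  exact ⟨μ, hbif, fun ν hν => (hν.eq_timeMap_sq hp').trans (hbif.eq_timeMap_sq hp').symm⟩

end BifurcationValue

section Reduction

variable {p α s : ℝ}

/-- The contribution of `u sin² u` to the rescaled potential:
`∫ u in α s..α, u sin² u = α² * perturbation α s`. -/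
noncomputable def perturbation (α s : ℝ) : ℝ := ∫ t in s..1, t * sin (α * t) ^ 2

/-- The time map of the problem, rescaled so that it converges to `C0 p` as `α → ∞`. -/
noncomputable def reducedTime (p α : ℝ) : ℝ :=
  ∫ s in (0 : ℝ)..1, 1 / √(1 - s ^ (p + 1) + (p + 1) * α ^ (1 - p) * perturbation α s)

theorem potential_sub_potential (hp : p + 1 ≠ 0) (hα : 0 < α) (hs : 0 ≤ s) :
    potential p α - potential p (α * s) = α ^ (p + 1) / (p + 1) *
      (1 - s ^ (p + 1) + (p + 1) * α ^ (1 - p) * perturbation α s) := by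
  have hint : ∀ a b : ℝ, IntervalIntegrable (fun t => t * sin t ^ 2) volume a b := fun a b =>
    Continuous.intervalIntegrable (by fun_prop) a b
  have hosc : (∫ t in (0 : ℝ)..α, t * sin t ^ 2) - ∫ t in (0 : ℝ)..α * s, t * sin t ^ 2
      = α ^ 2 * perturbation α s := by
    rw [intervalIntegral.integral_interval_sub_left (hint 0 α) (hint 0 (α * s)), perturbation]
    calc ∫ t in α * s..α, t * sin t ^ 2
        = α * ∫ t in s..1, α * t * sin (α * t) ^ 2 := by
          rw [intervalIntegral.mul_integral_comp_mul_left (f := fun t => t * sin t ^ 2), mul_one]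
      _ = α ^ 2 * ∫ t in s..1, t * sin (α * t) ^ 2 := by
          simp only [mul_assoc, intervalIntegral.integral_const_mul, sq]
  have hpow : α ^ (p + 1) * α ^ (1 - p) = α ^ 2 := by
    rw [← Real.rpow_add hα, ← Real.rpow_two]; ring_nf
  rw [potential, potential, add_sub_add_comm, hosc, Real.mul_rpow hα.le hs, ← hpow]
  field_simp

theorem timeMap_potential (hp : 0 < p + 1) (hα : 0 < α) :
    timeMap (potential p) α = α / √(α ^ (p + 1) / (p + 1)) * reducedTime p α := by
  have hscale := intervalIntegral.mul_integral_comp_mul_left (a := 0) (b := 1) (c := α)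
    (f := fun u => 1 / √(potential p α - potential p u))
  rw [mul_zero, mul_one] at hscale
  rw [timeMap, ← hscale, div_mul_eq_mul_div, mul_div_assoc, reducedTime,
    ← intervalIntegral.integral_div]
  congr 1
  refine intervalIntegral.integral_congr_Ioo_of_le zero_le_one fun s hs => ?_
  rw [potential_sub_potential hp.ne' hα hs.1.le, Real.sqrt_mul (by positivity), div_div,
    mul_comm]

theorem IsBifurcationValue.eq_reducedTime_sq {μ : ℝ} (hp : 0 < p + 1) (hα : 0 < α)
    (h : IsBifurcationValue p α μ) :
    μ = 2 * (p + 1) * α ^ (1 - p) * reducedTime p α ^ 2 := by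
  have hpow : α ^ (1 - p) = α ^ 2 / α ^ (p + 1) := by
    rw [← Real.rpow_two, ← Real.rpow_sub hα]; ring_nf
  have := Real.rpow_pos_of_pos hα (p + 1)
  rw [h.eq_timeMap_sq hp.ne', timeMap_potential hp hα, mul_pow, div_pow,
    Real.sq_sqrt (by positivity), hpow]
  field_simp

theorem perturbation_nonneg (α : ℝ) (hs : s ∈ Icc (0 : ℝ) 1) : 0 ≤ perturbation α s :=
  intervalIntegral.integral_nonneg hs.2 fun _ ht =>
    mul_nonneg (hs.1.trans ht.1) (sq_nonneg _)

theorem perturbation_le (α : ℝ) (hs : s ∈ Icc (0 : ℝ) 1) : perturbation α s ≤ (1 - s ^ 2) / 2 := by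
  calc perturbation α s ≤ ∫ t in s..1, t :=
        intervalIntegral.integral_mono_on hs.2 (Continuous.intervalIntegrable (by fun_prop) _ _)
          (Continuous.intervalIntegrable (by fun_prop) _ _) fun t ht =>
            mul_le_of_le_one_right (hs.1.trans ht.1) (sin_sq_le_one _)
    _ = (1 - s ^ 2) / 2 := by rw [integral_id, one_pow]

theorem perturbation_eq (hα : α ≠ 0) (s : ℝ) :
    perturbation α s = (1 - s ^ 2) / 4 - (sin (2 * α) - s * sin (2 * α * s)) / (4 * α)
      - (cos (2 * α) - cos (2 * α * s)) / (8 * α ^ 2) := by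
  have hderiv : ∀ t, HasDerivAt
      (fun t => t ^ 2 / 4 - t * sin (2 * α * t) / (4 * α) - cos (2 * α * t) / (8 * α ^ 2))
      (t * sin (α * t) ^ 2) t := fun t => by
    have hlin : HasDerivAt (fun t => 2 * α * t) (2 * α) t := hasDerivAt_const_mul (2 * α)
    refine (((((hasDerivAt_pow 2 t).div_const 4).sub
      (((hasDerivAt_id t).mul hlin.sin).div_const (4 * α))).sub
      (hlin.cos.div_const (8 * α ^ 2))).congr_deriv ?_)
    have hsin : sin (α * t) ^ 2 = (1 - cos (2 * α * t)) / 2 := by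
      rw [mul_assoc, Real.cos_two_mul, Real.cos_sq']; ring
    simp only [hsin, id]
    push_cast
    field_simp
    ring
  rw [perturbation, intervalIntegral.integral_eq_sub_of_hasDerivAt (fun t _ => hderiv t)
    (Continuous.intervalIntegrable (by fun_prop) _ _), mul_one]
  ring

theorem continuous_perturbation (α : ℝ) : Continuous (perturbation α) := by
  have hsymm : perturbation α = fun s => -∫ t in (1 : ℝ)..s, t * sin (α * t) ^ 2 :=
    funext fun _ => intervalIntegral.integral_symm _ _
  rw [hsymm]
  exact (intervalIntegral.continuous_primitive
    (fun a b => Continuous.intervalIntegrable (by fun_prop) a b) 1).neg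

end Reduction

section Expansion

theorem rpow_three_halves {x : ℝ} (hx : 0 ≤ x) : x ^ (3 / 2 : ℝ) = √x ^ 3 := by
  rw [Real.rpow_div_two_eq_sqrt _ hx]; norm_cast

theorem rpow_five_halves {x : ℝ} (hx : 0 ≤ x) : x ^ (5 / 2 : ℝ) = √x ^ 5 := by
  rw [Real.rpow_div_two_eq_sqrt _ hx]; norm_cast

theorem abs_one_div_sqrt_one_add_sub_le {x : ℝ} (hx : 0 ≤ x) :
    |1 / √(1 + x) - (1 - x / 2 + 3 / 8 * x ^ 2)| ≤ x ^ 3 := by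
  have hsq : √(1 + x) ^ 2 = 1 + x := Real.sq_sqrt (by linarith)
  have hone : 1 ≤ √(1 + x) := Real.one_le_sqrt.2 (by linarith)
  generalize √(1 + x) = z at *
  obtain rfl : x = z ^ 2 - 1 := by linarith
  have hz : 0 ≤ z - 1 := by linarith
  have hfactor : 1 / z - (1 - (z ^ 2 - 1) / 2 + 3 / 8 * (z ^ 2 - 1) ^ 2)
      = -((z - 1) ^ 3 * ((3 * z ^ 2 + 9 * z + 8) / (8 * z))) := by
    field_simp
    ring
  have hquot : (3 * z ^ 2 + 9 * z + 8) / (8 * z) ≤ (z + 1) ^ 3 := by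
    rw [div_le_iff₀ (by positivity)]
    nlinarith [mul_nonneg hz hz, mul_nonneg (mul_nonneg hz hz) hz,
      mul_nonneg (mul_nonneg hz hz) (mul_nonneg hz hz)]
  rw [hfactor, abs_neg, abs_of_nonneg (by positivity)]
  calc (z - 1) ^ 3 * ((3 * z ^ 2 + 9 * z + 8) / (8 * z)) ≤ (z - 1) ^ 3 * (z + 1) ^ 3 := by gcongr
    _ = (z ^ 2 - 1) ^ 3 := by ring

theorem abs_one_div_sqrt_add_sub_le {h b : ℝ} (hh : 0 < h) (hb : 0 ≤ b) :
    |1 / √(h + b) - (1 / √h - 1 / 2 * (b / h ^ (3 / 2 : ℝ)) + 3 / 8 * (b ^ 2 / h ^ (5 / 2 : ℝ)))|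
      ≤ (b / h) ^ 3 * (1 / √h) := by
  have hscale : 1 / √(h + b)
      - (1 / √h - 1 / 2 * (b / h ^ (3 / 2 : ℝ)) + 3 / 8 * (b ^ 2 / h ^ (5 / 2 : ℝ)))
      = (1 / √(1 + b / h) - (1 - b / h / 2 + 3 / 8 * (b / h) ^ 2)) * (1 / √h) := by
    have hsplit : √(h + b) = √h * √(1 + b / h) := by
      rw [← Real.sqrt_mul hh.le]
      congr 1
      field_simp
    have h3 : h ^ (3 / 2 : ℝ) = h * √h := by
      rw [rpow_three_halves hh.le, pow_succ, Real.sq_sqrt hh.le]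
    have h5 : h ^ (5 / 2 : ℝ) = h ^ 2 * √h := by
      rw [rpow_five_halves hh.le, pow_succ, pow_mul _ 2 2, Real.sq_sqrt hh.le]
    have : 0 < √h := Real.sqrt_pos.2 hh
    rw [hsplit, h3, h5]
    field_simp
  rw [hscale, abs_mul, abs_of_nonneg (by positivity : 0 ≤ 1 / √h)]
  gcongr
  exact abs_one_div_sqrt_one_add_sub_le (by positivity)

theorem abs_div_rpow_le {h b K r : ℝ} (hh : 0 < h) (hb : |b| ≤ K * h ^ (r - 1 / 2)) :
    |b / h ^ r| ≤ K * (1 / √h) := by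
  have hr := Real.rpow_pos_of_pos hh r
  rw [abs_div, abs_of_pos hr, div_le_iff₀ hr]
  calc |b| ≤ K * h ^ (r - 1 / 2) := hb
    _ = K * (1 / √h) * h ^ r := by rw [Real.rpow_sub hh, ← Real.sqrt_eq_rpow]; ring

variable {Ω : Type*} [MeasurableSpace Ω] {ν : Measure Ω} {h b : Ω → ℝ} {K : ℝ}

theorem integrable_div_rpow {r : ℝ} (hh : AEMeasurable h ν) (hb : AEMeasurable b ν)
    (hpos : ∀ᵐ x ∂ν, 0 < h x) (hint : Integrable (fun x => 1 / √(h x)) ν)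
    (hle : ∀ᵐ x ∂ν, |b x| ≤ K * h x ^ (r - 1 / 2)) :
    Integrable (fun x => b x / h x ^ r) ν := by
  refine (hint.const_mul K).mono' (AEMeasurable.aestronglyMeasurable (by fun_prop)) ?_
  filter_upwards [hpos, hle] with x hx hbx
  exact abs_div_rpow_le hx hbx

theorem abs_integral_one_div_sqrt_add_sub_le {ε : ℝ} (hh : AEMeasurable h ν)
    (hb : AEMeasurable b ν) (hpos : ∀ᵐ x ∂ν, 0 < h x)
    (hint : Integrable (fun x => 1 / √(h x)) ν)
    (hb0 : ∀ᵐ x ∂ν, 0 ≤ b x) (hle : ∀ᵐ x ∂ν, b x ≤ K * h x) (hε : 0 ≤ ε) :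
    |(∫ x, 1 / √(h x + ε * b x) ∂ν) - ((∫ x, 1 / √(h x) ∂ν)
        - ε / 2 * (∫ x, b x / h x ^ (3 / 2 : ℝ) ∂ν)
        + 3 / 8 * ε ^ 2 * ∫ x, b x ^ 2 / h x ^ (5 / 2 : ℝ) ∂ν)|
      ≤ (ε * K) ^ 3 * ∫ x, 1 / √(h x) ∂ν := by
  have hint₁ : Integrable (fun x => b x / h x ^ (3 / 2 : ℝ)) ν := by
    refine integrable_div_rpow (K := K) hh hb hpos hint ?_
    filter_upwards [hb0, hle] with x hx0 hx
    rwa [abs_of_nonneg hx0, (by norm_num : (3 / 2 - 1 / 2 : ℝ) = 1), Real.rpow_one]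
  have hint₂ : Integrable (fun x => b x ^ 2 / h x ^ (5 / 2 : ℝ)) ν := by
    refine integrable_div_rpow (K := K ^ 2) hh (hb.pow_const 2) hpos hint ?_
    filter_upwards [hb0, hle] with x hx0 hx
    rw [abs_of_nonneg (sq_nonneg _), (by norm_num : (5 / 2 - 1 / 2 : ℝ) = 2), Real.rpow_two,
      ← mul_pow]
    gcongr
  have hint₀ : Integrable (fun x => 1 / √(h x + ε * b x)) ν := by
    refine hint.mono' (AEMeasurable.aestronglyMeasurable (by fun_prop)) ?_
    filter_upwards [hpos, hb0] with x hx hx0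
    rw [Real.norm_of_nonneg (by positivity)]
    exact one_div_le_one_div_of_le (Real.sqrt_pos.2 hx)
      (Real.sqrt_le_sqrt (le_add_of_nonneg_right (by positivity)))
  have hlin : Integrable (fun x => 1 / √(h x) - ε / 2 * (b x / h x ^ (3 / 2 : ℝ))) ν :=
    hint.sub (hint₁.const_mul _)
  have hquad : Integrable (fun x => 1 / √(h x) - ε / 2 * (b x / h x ^ (3 / 2 : ℝ))
      + 3 / 8 * ε ^ 2 * (b x ^ 2 / h x ^ (5 / 2 : ℝ))) ν := hlin.add (hint₂.const_mul _)
  rw [← integral_const_mul, ← integral_const_mul, ← integral_const_mul,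
    ← integral_sub hint (hint₁.const_mul _), ← integral_add hlin (hint₂.const_mul _),
    ← integral_sub hint₀ hquad, ← Real.norm_eq_abs]
  refine norm_integral_le_of_norm_le (hint.const_mul _) ?_
  filter_upwards [hpos, hb0, hle] with x hx hx0 hxK
  calc _ = |1 / √(h x + ε * b x) - (1 / √(h x) - 1 / 2 * (ε * b x / h x ^ (3 / 2 : ℝ))
          + 3 / 8 * ((ε * b x) ^ 2 / h x ^ (5 / 2 : ℝ)))| := by
        rw [Real.norm_eq_abs]
        congr 1
        ring
    _ ≤ (ε * b x / h x) ^ 3 * (1 / √(h x)) := abs_one_div_sqrt_add_sub_le hx (by positivity)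
    _ ≤ (ε * K) ^ 3 * (1 / √(h x)) := by
        gcongr
        rw [div_le_iff₀ hx, mul_assoc]
        gcongr

end Expansion

section Weight

variable {q s : ℝ}

theorem one_sub_le_one_sub_rpow (hq : 1 ≤ q) (hs : s ∈ Icc (0 : ℝ) 1) : 1 - s ≤ 1 - s ^ q :=
  sub_le_sub_left (Real.rpow_le_self_of_le_one hs.1 hs.2 hq) 1

theorem one_sub_sq_le_one_sub_rpow (hq : 2 ≤ q) (hs : s ∈ Icc (0 : ℝ) 1) :
    1 - s ^ 2 ≤ 1 - s ^ q := by
  rw [← Real.rpow_two]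
  exact sub_le_sub_left
    (Real.rpow_le_rpow_of_exponent_ge_of_imp hs.1 hs.2 hq fun _ h => by linarith) 1

theorem one_sub_rpow_pos (hq : 0 < q) (hs : s ∈ Ico (0 : ℝ) 1) : 0 < 1 - s ^ q :=
  sub_pos.2 (Real.rpow_lt_one hs.1 hs.2 hq)

theorem one_div_sqrt_one_sub_rpow_le (hq : 1 ≤ q) (hs : s ∈ Ico (0 : ℝ) 1) :
    1 / √(1 - s ^ q) ≤ 1 / √(1 - s) :=
  one_div_le_one_div_of_le (Real.sqrt_pos.2 (sub_pos.2 hs.2))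
    (Real.sqrt_le_sqrt (one_sub_le_one_sub_rpow hq ⟨hs.1, hs.2.le⟩))

theorem intervalIntegrable_one_sub_rpow {r : ℝ} (hr : -1 < r) :
    IntervalIntegrable (fun s : ℝ => (1 - s) ^ r) volume 0 1 := by
  simpa using ((intervalIntegral.intervalIntegrable_rpow' (a := 0) (b := 1) hr).comp_sub_left
    1).symm

theorem integrableOn_one_div_sqrt (hq : 1 ≤ q) :
    IntegrableOn (fun s : ℝ => 1 / √(1 - s ^ q)) (Ioo 0 1) := by
  refine Integrable.mono' ((intervalIntegrable_iff_integrableOn_Ioo_of_le zero_le_one).1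
    (intervalIntegrable_one_sub_rpow (r := -(1 / 2)) (by norm_num)))
    (Measurable.aestronglyMeasurable (by fun_prop)) ?_
  refine ae_restrict_of_forall_mem measurableSet_Ioo fun s hs => ?_
  rw [Real.norm_of_nonneg (by positivity), Real.rpow_neg (sub_nonneg.2 hs.2.le),
    ← Real.sqrt_eq_rpow, ← one_div]
  exact one_div_sqrt_one_sub_rpow_le hq ⟨hs.1.le, hs.2⟩

theorem intervalIntegrable_div_one_sub_rpow {f : ℝ → ℝ} {K r : ℝ} (hq : 1 ≤ q)
    (hf : ContinuousOn f (Ioo 0 1))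
    (hle : ∀ s ∈ Ioo (0 : ℝ) 1, |f s| ≤ K * (1 - s ^ q) ^ (r - 1 / 2)) :
    IntervalIntegrable (fun s => f s / (1 - s ^ q) ^ r) volume 0 1 :=
  (intervalIntegrable_iff_integrableOn_Ioo_of_le zero_le_one).2 <|
    integrable_div_rpow (K := K) (by fun_prop) (hf.aemeasurable measurableSet_Ioo)
      (ae_restrict_of_forall_mem measurableSet_Ioo fun _ hs =>
        one_sub_rpow_pos (by linarith) ⟨hs.1.le, hs.2⟩)
      (integrableOn_one_div_sqrt hq) (ae_restrict_of_forall_mem measurableSet_Ioo hle)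

theorem intervalIntegrable_div_sqrt {f : ℝ → ℝ} (hq : 1 ≤ q) (hf : Continuous f) :
    IntervalIntegrable (fun s => f s / √(1 - s ^ q)) volume 0 1 := by
  have := ((intervalIntegrable_iff_integrableOn_Ioo_of_le zero_le_one).2
    (integrableOn_one_div_sqrt hq)).continuousOn_mul hf.continuousOn
  simpa only [mul_one_div] using this

theorem exists_abs_le_mul_one_sub {φ : ℝ → ℝ} (hφ : ContDiff ℝ 1 φ) (h1 : φ 1 = 0) :
    ∃ C, ∀ s ∈ Icc (0 : ℝ) 1, |φ s| ≤ C * (1 - s) := by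
  obtain ⟨C, hC⟩ := hφ.contDiffOn.exists_lipschitzOnWith one_ne_zero (convex_Icc (0 : ℝ) 1)
    isCompact_Icc
  refine ⟨C, fun s hs => ?_⟩
  have := hC.dist_le_mul s hs 1 ⟨zero_le_one, le_rfl⟩
  rwa [h1, Real.dist_eq, sub_zero, dist_comm, Real.dist_eq, abs_of_nonneg (sub_nonneg.2 hs.2)]
    at this

theorem intervalIntegrable_div_three_halves {φ : ℝ → ℝ} (hq : 1 ≤ q) (hφ : ContDiff ℝ 1 φ)
    (h1 : φ 1 = 0) :
    IntervalIntegrable (fun s => φ s / (1 - s ^ q) ^ (3 / 2 : ℝ)) volume 0 1 := by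
  obtain ⟨C, hC⟩ := exists_abs_le_mul_one_sub hφ h1
  have hC0 : 0 ≤ C := by simpa using (abs_nonneg _).trans (hC 0 ⟨le_rfl, zero_le_one⟩)
  refine intervalIntegrable_div_one_sub_rpow (K := C) hq hφ.continuous.continuousOn fun s hs => ?_
  have hs' := Ioo_subset_Icc_self hs
  rw [(by norm_num : (3 / 2 - 1 / 2 : ℝ) = 1), Real.rpow_one]
  exact (hC s hs').trans (mul_le_mul_of_nonneg_left (one_sub_le_one_sub_rpow hq hs') hC0)

theorem hasDerivAt_div_sqrt_one_sub_rpow (hq : 0 < q) (hs : s ∈ Ioo (0 : ℝ) 1) :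
    HasDerivAt (fun s : ℝ => s / √(1 - s ^ q))
      (q / 2 * (1 / (1 - s ^ q) ^ (3 / 2 : ℝ)) - (q / 2 - 1) * (1 / √(1 - s ^ q))) s := by
  have hpos := one_sub_rpow_pos hq ⟨hs.1.le, hs.2⟩
  have hsqrt : 0 < √(1 - s ^ q) := Real.sqrt_pos.2 hpos
  have hsq : √(1 - s ^ q) ^ 2 = 1 - s ^ q := Real.sq_sqrt hpos.le
  have hpow : s * s ^ (q - 1) = 1 - √(1 - s ^ q) ^ 2 := by
    rw [hsq, sub_sub_cancel, Real.rpow_sub_one hs.1.ne', mul_div_cancel₀ _ hs.1.ne']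
  refine ((hasDerivAt_id s).div (((Real.hasDerivAt_rpow_const (x := s) (p := q)
    (Or.inl hs.1.ne')).const_sub 1).sqrt hpos.ne') hsqrt.ne').congr_deriv ?_
  rw [rpow_three_halves hpos.le, id]
  generalize √(1 - s ^ q) = k at *
  field_simp
  linear_combination q * hpow

theorem tendsto_mul_div_sqrt_one_sub_rpow {φ : ℝ → ℝ} (hq : 1 ≤ q) (hφ : ContDiff ℝ 1 φ)
    (h1 : φ 1 = 0) : Tendsto (fun s => φ s * (s / √(1 - s ^ q))) (𝓝[<] 1) (𝓝 0) := by
  obtain ⟨C, hC⟩ := exists_abs_le_mul_one_sub hφ h1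
  have hlim : Tendsto (fun s : ℝ => C * √(1 - s)) (𝓝[<] 1) (𝓝 0) := by
    have : Continuous fun s : ℝ => C * √(1 - s) := by fun_prop
    simpa using (this.tendsto 1).mono_left nhdsWithin_le_nhds
  refine squeeze_zero_norm' ?_ hlim
  filter_upwards [Ioo_mem_nhdsLT zero_lt_one] with s hs
  rw [norm_mul, Real.norm_eq_abs, Real.norm_of_nonneg (div_nonneg hs.1.le (Real.sqrt_nonneg _))]
  calc |φ s| * (s / √(1 - s ^ q)) ≤ C * (1 - s) * (1 / √(1 - s)) := by
        have hφs := hC s (Ioo_subset_Icc_self hs)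
        refine mul_le_mul hφs ?_ (div_nonneg hs.1.le (Real.sqrt_nonneg _))
          ((abs_nonneg _).trans hφs)
        exact (div_le_div_of_nonneg_right hs.2.le (Real.sqrt_nonneg _)).trans
          (one_div_sqrt_one_sub_rpow_le hq ⟨hs.1.le, hs.2⟩)
    _ = C * √(1 - s) := by rw [mul_assoc, mul_one_div, Real.div_sqrt]

theorem integral_div_three_halves {φ : ℝ → ℝ} (hq : 1 ≤ q) (hφ : ContDiff ℝ 1 φ)
    (h1 : φ 1 = 0) :
    q / 2 * ∫ s in (0 : ℝ)..1, φ s / (1 - s ^ q) ^ (3 / 2 : ℝ) =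
      (q / 2 - 1) * (∫ s in (0 : ℝ)..1, φ s / √(1 - s ^ q))
        - ∫ s in (0 : ℝ)..1, deriv φ s * s / √(1 - s ^ q) := by
  have hint₁ := (intervalIntegrable_div_three_halves hq hφ h1).const_mul (q / 2)
  have hint₂ := (intervalIntegrable_div_sqrt hq hφ.continuous).const_mul (q / 2 - 1)
  have hint₃ : IntervalIntegrable (fun s => deriv φ s * s / √(1 - s ^ q)) volume 0 1 :=
    intervalIntegrable_div_sqrt hq ((hφ.continuous_deriv le_rfl).mul continuous_id)
  have hderiv : ∀ s ∈ Ioo (0 : ℝ) 1, HasDerivAt (fun s => φ s * (s / √(1 - s ^ q)))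
      (deriv φ s * s / √(1 - s ^ q) + (q / 2 * (φ s / (1 - s ^ q) ^ (3 / 2 : ℝ))
        - (q / 2 - 1) * (φ s / √(1 - s ^ q)))) s := fun s hs =>
    ((hφ.differentiable one_ne_zero s).hasDerivAt.mul
      (hasDerivAt_div_sqrt_one_sub_rpow (by linarith) hs)).congr_deriv (by ring)
  have hzero : Tendsto (fun s => φ s * (s / √(1 - s ^ q))) (𝓝[>] 0) (𝓝 0) := by
    have : ContinuousAt (fun s => φ s * (s / √(1 - s ^ q))) 0 := by
      have h0 : √(1 - (0 : ℝ) ^ q) ≠ 0 := by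
        rw [Real.zero_rpow (by linarith)]; norm_num
      have := hφ.continuous
      have : Continuous fun s : ℝ => s ^ q := Real.continuous_rpow_const (by linarith)
      exact ContinuousAt.mul (by fun_prop) (ContinuousAt.div (by fun_prop) (by fun_prop) h0)
    simpa using this.tendsto.mono_left nhdsWithin_le_nhds
  have hparts := intervalIntegral.integral_eq_sub_of_hasDerivAt_of_tendsto zero_lt_one hderiv
    (hint₃.add (hint₁.sub hint₂)) hzero (tendsto_mul_div_sqrt_one_sub_rpow hq hφ h1)
  rw [intervalIntegral.integral_add hint₃ (hint₁.sub hint₂),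
    intervalIntegral.integral_sub hint₁ hint₂, intervalIntegral.integral_const_mul,
    intervalIntegral.integral_const_mul] at hparts
  linarith

theorem integral_comp_sin_rpow (hq : 0 < q) (F : ℝ → ℝ) :
    ∫ θ in (0 : ℝ)..(π / 2), F (sin θ ^ (2 / q)) * sin θ ^ (2 / q - 1) =
      q / 2 * ∫ s in (0 : ℝ)..1, F s / √(1 - s ^ q) := by
  have hpi := Real.pi_div_two_pos
  have hq2 : 0 < 2 / q := by positivity
  have hsin : ∀ θ ∈ Ioo 0 (π / 2), 0 < sin θ := fun θ hθ =>
    sin_pos_of_mem_Ioo ⟨hθ.1, by linarith [hθ.2]⟩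
  have hcos : ∀ θ ∈ Ioo 0 (π / 2), 0 < cos θ := fun θ hθ =>
    cos_pos_of_mem_Ioo ⟨by linarith [hθ.1], hθ.2⟩
  have hIoo : Ioo (min 0 (π / 2)) (max 0 (π / 2)) = Ioo 0 (π / 2) := by
    rw [min_eq_left hpi.le, max_eq_right hpi.le]
  have hsubst := intervalIntegral.integral_comp_mul_deriv_of_deriv_nonneg (a := 0) (b := π / 2)
    (f := fun θ => sin θ ^ (2 / q)) (f' := fun θ => cos θ * (2 / q) * sin θ ^ (2 / q - 1))
    (g := fun s => F s / √(1 - s ^ q))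
    (continuous_sin.rpow_const fun _ => Or.inr hq2.le).continuousOn
    (fun θ hθ => (Real.hasDerivAt_sin θ).rpow_const (Or.inl (hsin θ (hIoo ▸ hθ)).ne'))
    (fun θ hθ => by
      have := hsin θ (hIoo ▸ hθ)
      have := hcos θ (hIoo ▸ hθ)
      positivity)
  simp only [sin_zero, sin_pi_div_two, Real.zero_rpow hq2.ne', Real.one_rpow] at hsubst
  rw [← hsubst, ← intervalIntegral.integral_const_mul]
  refine intervalIntegral.integral_congr_Ioo_of_le hpi.le fun θ hθ => ?_
  have hweight : √(1 - (sin θ ^ (2 / q)) ^ q) = cos θ := by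
    rw [← Real.rpow_mul (hsin θ hθ).le, div_mul_cancel₀ _ hq.ne', Real.rpow_two, ← Real.cos_sq',
      Real.sqrt_sq (hcos θ hθ).le]
  have := (hcos θ hθ).ne'
  simp only [Function.comp_apply, hweight]
  field_simp

end Weight

section RiemannLebesgue

theorem tendsto_integral_mul_cos {f : ℝ → ℝ} (hf : Integrable f) :
    Tendsto (fun ω => ∫ s, f s * cos (ω * s)) atTop (𝓝 0) := by
  have hfreq : Tendsto (fun ω : ℝ => ω / (2 * π)) atTop (cocompact ℝ) :=
    (tendsto_id.atTop_div_const Real.two_pi_pos).mono_right atTop_le_cocompact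
  have hre := (Complex.continuous_re.tendsto 0).comp
    ((Real.tendsto_integral_exp_smul_cocompact fun s => (f s : ℂ)).comp hfreq)
  refine hre.congr fun ω => ?_
  have hchar : ∀ s, Real.fourierChar (-(s * (ω / (2 * π)))) • (f s : ℂ)
      = Complex.exp ((-(ω * s) : ℝ) * Complex.I) * f s := fun s => by
    rw [Circle.smul_def, Real.fourierChar_apply, smul_eq_mul]
    congr 4
    field_simp
  have hint : Integrable fun s => Complex.exp ((-(ω * s) : ℝ) * Complex.I) * (f s : ℂ) :=
    hf.ofReal.bdd_mul (c := 1) (Continuous.aestronglyMeasurable (by fun_prop))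
      (Eventually.of_forall fun s => (Complex.norm_exp_ofReal_mul_I _).le)
  simp only [Function.comp_apply, hchar]
  rw [← Complex.reCLM_apply, ← ContinuousLinearMap.integral_comp_comm _ hint]
  simp only [Complex.reCLM_apply, Complex.re_mul_ofReal, Complex.exp_ofReal_mul_I_re, cos_neg,
    mul_comm (cos _)]

theorem tendsto_intervalIntegral_mul_cos {f : ℝ → ℝ} {a b : ℝ}
    (hf : IntervalIntegrable f volume a b) :
    Tendsto (fun ω => ∫ s in a..b, f s * cos (ω * s)) atTop (𝓝 0) := by
  have hset : ∀ u v, IntegrableOn f (Ioc u v) →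
      Tendsto (fun ω => ∫ s in Ioc u v, f s * cos (ω * s)) atTop (𝓝 0) := fun u v h => by
    refine (tendsto_integral_mul_cos (h.integrable_indicator measurableSet_Ioc)).congr fun ω => ?_
    simp only [← integral_indicator measurableSet_Ioc, indicator_mul_left]
  simpa only [intervalIntegral, sub_zero] using (hset a b hf.1).sub (hset b a hf.2)

theorem isBigO_one_intervalIntegral_mul {ι : Type*} {l : Filter ι} {f : ℝ → ℝ} {k : ι → ℝ → ℝ}
    {a b C : ℝ} (hf : IntervalIntegrable f volume a b) (hk : ∀ i s, |k i s| ≤ C) :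
    (fun i => ∫ s in a..b, f s * k i s) =O[l] fun _ => (1 : ℝ) := by
  refine IsBigO.of_bound |∫ s in a..b, |f s| * C| (Eventually.of_forall fun i => ?_)
  rw [norm_one, mul_one]
  refine intervalIntegral.norm_integral_le_abs_of_norm_le (Eventually.of_forall fun s => ?_)
    (hf.abs.mul_const C)
  rw [norm_mul]
  exact mul_le_mul_of_nonneg_left (hk i s) (abs_nonneg _)

theorem intervalIntegrable_primitive {f : ℝ → ℝ} {K r : ℝ} (hr0 : 0 < r) (hr1 : r < 1)
    (hf : ContinuousOn f (Ico 0 1)) (hle : ∀ y ∈ Ico (0 : ℝ) 1, |f y| ≤ K * (1 - y) ^ (-r - 1)) :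
    IntervalIntegrable (fun s => ∫ y in (0 : ℝ)..s, f y) volume 0 1 := by
  have hK : 0 ≤ K := by simpa using (abs_nonneg _).trans (hle 0 ⟨le_rfl, zero_lt_one⟩)
  have hsub : ∀ s ∈ Ioo (0 : ℝ) 1, uIcc 0 s ⊆ Ico 0 1 := fun s hs => by
    rw [uIcc_of_le hs.1.le]
    exact Icc_subset_Ico_right hs.2
  have hcont : ContinuousOn (fun s => ∫ y in (0 : ℝ)..s, f y) (Ioo 0 1) := fun s hs =>
    (intervalIntegral.integral_hasDerivAt_right (hf.mono (hsub s hs)).intervalIntegrable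
      ((hf.mono Ioo_subset_Ico_self).stronglyMeasurableAtFilter isOpen_Ioo s hs)
      (hf.continuousAt (Ico_mem_nhds hs.1 hs.2))).continuousAt.continuousWithinAt
  rw [intervalIntegrable_iff_integrableOn_Ioo_of_le zero_le_one]
  refine Integrable.mono' (((intervalIntegrable_iff_integrableOn_Ioo_of_le zero_le_one).1
    (intervalIntegrable_one_sub_rpow (r := -r) (by linarith))).const_mul (K / r))
    (hcont.aestronglyMeasurable measurableSet_Ioo)
    (ae_restrict_of_forall_mem measurableSet_Ioo fun s hs => ?_)
  have hmajorant : IntervalIntegrable (fun y : ℝ => K * (1 - y) ^ (-r - 1)) volume 0 s :=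
    ContinuousOn.intervalIntegrable (continuousOn_const.mul (ContinuousOn.rpow_const (by fun_prop)
      fun y hy => Or.inl (sub_pos.2 (hsub s hs hy).2).ne'))
  calc ‖∫ y in (0 : ℝ)..s, f y‖ ≤ ∫ y in (0 : ℝ)..s, K * (1 - y) ^ (-r - 1) :=
        intervalIntegral.norm_integral_le_of_norm_le hs.1.le (Eventually.of_forall fun y hy =>
          hle y ⟨hy.1.le, hy.2.trans_lt hs.2⟩) hmajorant
    _ = K / r * ((1 - s) ^ (-r) - 1) := by
        have hne : (0 : ℝ) ∉ uIcc (1 - s) (1 - 0) := by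
          rw [uIcc_of_le (by linarith [hs.1])]
          exact fun h => by linarith [h.1, hs.2]
        rw [intervalIntegral.integral_const_mul,
          intervalIntegral.integral_comp_sub_left (fun y => y ^ (-r - 1)) 1,
          integral_rpow (Or.inr ⟨by linarith, hne⟩), sub_add_cancel, sub_zero, Real.one_rpow]
        field_simp
        ring
    _ ≤ K / r * (1 - s) ^ (-r) := mul_le_mul_of_nonneg_left (by linarith) (by positivity)

end RiemannLebesgue

section Coefficients

variable {p : ℝ}

theorem integral_comp_sin_rpow_mul {q : ℝ} (hq : 0 < q) (F : ℝ → ℝ) :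
    ∫ θ in (0 : ℝ)..(π / 2), F (sin θ ^ (2 / q)) * sin θ ^ (4 / q - 1) =
      q / 2 * ∫ s in (0 : ℝ)..1, F s * s / √(1 - s ^ q) := by
  rw [← integral_comp_sin_rpow hq fun s => F s * s]
  refine intervalIntegral.integral_congr_Ioo_of_le Real.pi_div_two_pos.le fun θ hθ => ?_
  have hsin : 0 < sin θ := sin_pos_of_mem_Ioo ⟨hθ.1, by linarith [hθ.2, Real.pi_pos]⟩
  have hexp : 4 / q - 1 = 2 / q + (2 / q - 1) := by ring
  simp only [hexp, Real.rpow_add hsin, mul_assoc]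

theorem C11_eq (hp : 0 < p + 1) (α : ℝ) :
    C11 p α = ∫ s in (0 : ℝ)..1, cos (2 * α * s) * s / √(1 - s ^ (p + 1)) := by
  have hexp : (3 - p) / (p + 1) = 4 / (p + 1) - 1 := by field_simp; ring
  rw [C11, hexp, integral_comp_sin_rpow_mul hp fun s => cos (2 * α * s)]
  field_simp

theorem C21_eq (hp : 0 < p + 1) (α : ℝ) :
    C21 p α = -(1 / 2) * ∫ s in (0 : ℝ)..1, sin (2 * α * s) * s / √(1 - s ^ (p + 1)) := by
  have hexp : (3 - p) / (p + 1) = 4 / (p + 1) - 1 := by field_simp; ring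
  rw [C21, hexp, integral_comp_sin_rpow_mul hp fun s => sin (2 * α * s)]
  field_simp

theorem C12_eq (hp : 0 < p + 1) (α : ℝ) :
    C12 p α = (p - 1) / 4 * (∫ s in (0 : ℝ)..1,
        (sin (2 * α) - sin (2 * α * s)) / √(1 - s ^ (p + 1)))
      + (p + 1) / 4 * ∫ s in (0 : ℝ)..1,
        (1 - s) / (1 - s ^ (p + 1)) ^ (3 / 2 : ℝ) * sin (2 * α * s) := by
  have hexp : (1 - p) / (p + 1) = 2 / (p + 1) - 1 := by field_simp; ring
  rw [C12, hexp, integral_comp_sin_rpow hp fun s => sin (2 * α) - sin (2 * α * s)]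
  field_simp
  ring

theorem intervalIntegrable_one_sub_div (hp : 0 ≤ p) : IntervalIntegrable
    (fun s : ℝ => (1 - s) / (1 - s ^ (p + 1)) ^ (3 / 2 : ℝ)) volume 0 1 :=
  intervalIntegrable_div_three_halves (by linarith) (by fun_prop) (sub_self 1)

theorem isBigO_one_integral_sub_div_sqrt {q : ℝ} {l : Filter ℝ} {f : ℝ → ℝ} (hq : 1 ≤ q)
    (hf : ∀ x, |f x| ≤ 1) :
    (fun α => ∫ s in (0 : ℝ)..1, (f (2 * α) - f (2 * α * s)) / √(1 - s ^ q))
      =O[l] fun _ => (1 : ℝ) := by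
  have hk : ∀ α s, |f (2 * α) - f (2 * α * s)| ≤ 2 := fun α s =>
    (abs_sub _ _).trans (by linarith [hf (2 * α), hf (2 * α * s)])
  refine (isBigO_one_intervalIntegral_mul
    (intervalIntegrable_div_sqrt (f := fun _ => 1) hq continuous_const) hk).congr_left fun α => ?_
  simp only [one_div_mul_eq_div]

theorem isBigO_one_C12 (hp : 0 ≤ p) : C12 p =O[atTop] fun _ => (1 : ℝ) := by
  have hsum := ((isBigO_one_integral_sub_div_sqrt (l := atTop) (by linarith : 1 ≤ p + 1)
    abs_sin_le_one).const_mul_left ((p - 1) / 4)).add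
    ((isBigO_one_intervalIntegral_mul (intervalIntegrable_one_sub_div hp)
      fun α s => abs_sin_le_one (2 * α * s)).const_mul_left ((p + 1) / 4))
  exact hsum.congr_left fun α => (C12_eq (by linarith) α).symm

theorem isBigO_one_C21 (hp : 0 ≤ p) : C21 p =O[atTop] fun _ => (1 : ℝ) := by
  have hint := isBigO_one_intervalIntegral_mul (l := atTop)
    (intervalIntegrable_div_sqrt (by linarith : 1 ≤ p + 1) continuous_id)
    fun α s => abs_sin_le_one (2 * α * s)
  refine (hint.const_mul_left (-(1 / 2))).congr_left fun α => ?_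
  rw [C21_eq (by linarith)]
  simp only [id, div_mul_eq_mul_div, mul_comm (sin _)]

theorem tendsto_C3 (hp : 1 ≤ p) : Tendsto (C3 p) atTop (𝓝 0) := by
  have hpos : ∀ y ∈ Ico (0 : ℝ) 1, 0 < 1 - y ^ (p + 1) := fun y => one_sub_rpow_pos (by linarith)
  have hcont : ContinuousOn (fun y : ℝ => (1 - y ^ 2) / (1 - y ^ (p + 1)) ^ (5 / 2 : ℝ))
      (Ico 0 1) := by
    have : Continuous fun y : ℝ => y ^ (p + 1) := Real.continuous_rpow_const (by linarith)
    exact ContinuousOn.div (by fun_prop)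
      (ContinuousOn.rpow_const (by fun_prop) fun y hy => Or.inl (hpos y hy).ne')
      fun y hy => (Real.rpow_pos_of_pos (hpos y hy) _).ne'
  have hle : ∀ y ∈ Ico (0 : ℝ) 1, |(1 - y ^ 2) / (1 - y ^ (p + 1)) ^ (5 / 2 : ℝ)|
      ≤ 1 * (1 - y) ^ (-(1 / 2) - 1 : ℝ) := fun y hy => by
    have hy' := Ico_subset_Icc_self hy
    have hsub : 0 < 1 - y := sub_pos.2 hy.2
    have h := hpos y hy
    rw [abs_of_nonneg (div_nonneg (by nlinarith [hy.1]) (by positivity)), one_mul]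
    calc (1 - y ^ 2) / (1 - y ^ (p + 1)) ^ (5 / 2 : ℝ)
        ≤ (1 - y ^ (p + 1)) / (1 - y ^ (p + 1)) ^ (5 / 2 : ℝ) :=
          div_le_div_of_nonneg_right (one_sub_sq_le_one_sub_rpow (by linarith) hy') (by positivity)
      _ = (1 - y ^ (p + 1)) ^ (-(1 / 2) - 1 : ℝ) := by
          nth_rw 1 [← Real.rpow_one (1 - y ^ (p + 1))]
          rw [← Real.rpow_sub h]
          norm_num
      _ ≤ (1 - y) ^ (-(1 / 2) - 1 : ℝ) :=
          Real.rpow_le_rpow_of_nonpos hsub (one_sub_le_one_sub_rpow (by linarith) hy')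
            (by norm_num)
  have hprim := intervalIntegrable_primitive (by norm_num) (by norm_num) hcont hle
  have hlim := ((tendsto_intervalIntegral_mul_cos hprim).comp
    (tendsto_id.const_mul_atTop two_pos)).const_mul (-(3 / 32) * (p + 1) ^ 2)
  rwa [mul_zero] at hlim

end Coefficients

section Asymptotics

variable {p α : ℝ}

theorem integral_sin_sub_div (hp : 0 ≤ p) (α : ℝ) :
    (p + 1) / 2 * ∫ s in (0 : ℝ)..1,
        (sin (2 * α) - sin (2 * α * s)) / (1 - s ^ (p + 1)) ^ (3 / 2 : ℝ) =
      (p - 1) / 2 * (∫ s in (0 : ℝ)..1, (sin (2 * α) - sin (2 * α * s)) / √(1 - s ^ (p + 1)))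
        + 2 * α * C11 p α := by
  have hderiv : deriv (fun s => sin (2 * α) - sin (2 * α * s))
      = fun s => -(2 * α * cos (2 * α * s)) := funext fun s =>
    (((hasDerivAt_const_mul (2 * α)).sin.const_sub _).congr_deriv (by ring)).deriv
  rw [integral_div_three_halves (by linarith) (by fun_prop) (by simp), hderiv,
    C11_eq (by linarith), (by ring : (p + 1) / 2 - 1 = (p - 1) / 2)]
  simp only [neg_mul, neg_div, intervalIntegral.integral_neg, mul_assoc, mul_div_assoc,
    intervalIntegral.integral_const_mul, sub_neg_eq_add]

theorem integral_cos_sub_div (hp : 0 ≤ p) (α : ℝ) :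
    (p + 1) / 2 * ∫ s in (0 : ℝ)..1,
        (cos (2 * α) - cos (2 * α * s)) / (1 - s ^ (p + 1)) ^ (3 / 2 : ℝ) =
      (p - 1) / 2 * (∫ s in (0 : ℝ)..1, (cos (2 * α) - cos (2 * α * s)) / √(1 - s ^ (p + 1)))
        + 4 * α * C21 p α := by
  have hderiv : deriv (fun s => cos (2 * α) - cos (2 * α * s))
      = fun s => 2 * α * sin (2 * α * s) := funext fun s =>
    (((hasDerivAt_const_mul (2 * α)).cos.const_sub _).congr_deriv (by ring)).deriv
  rw [integral_div_three_halves (by linarith) (by fun_prop) (by simp), hderiv,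
    C21_eq (by linarith), (by ring : (p + 1) / 2 - 1 = (p - 1) / 2)]
  simp only [mul_assoc, mul_div_assoc, intervalIntegral.integral_const_mul]
  ring

theorem integral_perturbation_div (hp : 0 ≤ p) (hα : α ≠ 0) :
    (p + 1) / 2 * ∫ s in (0 : ℝ)..1, perturbation α s / (1 - s ^ (p + 1)) ^ (3 / 2 : ℝ) =
      -(C1 p + 1 / 2 * C11 p α) - (1 / 2 * C12 p α + 1 / 2 * C21 p α) / α
        - (p - 1) / (16 * α ^ 2) * ∫ s in (0 : ℝ)..1,
          (cos (2 * α) - cos (2 * α * s)) / √(1 - s ^ (p + 1)) := by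
  have hint : ∀ φ : ℝ → ℝ, ContDiff ℝ 1 φ → φ 1 = 0 →
      IntervalIntegrable (fun s => φ s / (1 - s ^ (p + 1)) ^ (3 / 2 : ℝ)) volume 0 1 :=
    fun φ => intervalIntegrable_div_three_halves (by linarith)
  have hmain := (hint (fun s => 1 - s ^ 2) (by fun_prop) (by norm_num)).const_mul (1 / 4)
  have hsin := (hint (fun s => sin (2 * α) - sin (2 * α * s)) (by fun_prop)
    (by simp)).const_mul (1 / (4 * α))
  have hedge := ((intervalIntegrable_one_sub_div hp).mul_continuousOn
    (g := fun s => sin (2 * α * s)) (by fun_prop)).const_mul (1 / (4 * α))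
  have hcos := (hint (fun s => cos (2 * α) - cos (2 * α * s)) (by fun_prop)
    (by simp)).const_mul (1 / (8 * α ^ 2))
  have hsplit : ∀ s, perturbation α s / (1 - s ^ (p + 1)) ^ (3 / 2 : ℝ) =
      1 / 4 * ((1 - s ^ 2) / (1 - s ^ (p + 1)) ^ (3 / 2 : ℝ))
      - 1 / (4 * α) * ((sin (2 * α) - sin (2 * α * s)) / (1 - s ^ (p + 1)) ^ (3 / 2 : ℝ))
      - 1 / (4 * α) * ((1 - s) / (1 - s ^ (p + 1)) ^ (3 / 2 : ℝ) * sin (2 * α * s))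
      - 1 / (8 * α ^ 2) * ((cos (2 * α) - cos (2 * α * s)) / (1 - s ^ (p + 1)) ^ (3 / 2 : ℝ)) :=
    fun s => by
      rw [perturbation_eq hα]
      ring
  simp only [hsplit]
  rw [intervalIntegral.integral_sub ((hmain.sub hsin).sub hedge) hcos,
    intervalIntegral.integral_sub (hmain.sub hsin) hedge, intervalIntegral.integral_sub hmain hsin]
  simp only [intervalIntegral.integral_const_mul]
  have hsin_parts := integral_sin_sub_div hp α
  have hcos_parts := integral_cos_sub_div hp α
  rw [C12_eq (by linarith), C1]
  field_simp
  linear_combination (-256 * α) * hsin_parts - 128 * hcos_parts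

theorem tendsto_perturbation (s : ℝ) :
    Tendsto (perturbation · s) atTop (𝓝 ((1 - s ^ 2) / 4)) := by
  have hint : IntervalIntegrable (fun t : ℝ => t) volume s 1 :=
    continuous_id.intervalIntegrable _ _
  have hosc := ((tendsto_intervalIntegral_mul_cos hint).comp
    (tendsto_id.const_mul_atTop two_pos)).const_sub ((1 - s ^ 2) / 2)
  have hhalf := hosc.const_mul (1 / 2)
  rw [sub_zero, (by ring : 1 / 2 * ((1 - s ^ 2) / 2) = (1 - s ^ 2) / 4)] at hhalf
  refine hhalf.congr fun α => ?_
  have hid : ∫ t in s..1, t = (1 - s ^ 2) / 2 := by rw [integral_id, one_pow]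
  simp only [Function.comp_apply, id]
  rw [perturbation, ← hid, ← intervalIntegral.integral_sub hint
    (Continuous.intervalIntegrable (by fun_prop) _ _), ← intervalIntegral.integral_const_mul]
  refine intervalIntegral.integral_congr fun t _ => ?_
  simp only [Real.sin_sq_eq_half_sub, mul_assoc]
  ring

end Asymptotics

section Remainder

variable {p α : ℝ}

/-- The second-order Taylor polynomial of `reducedTime`, as a function of the coefficient
`(p + 1) * α ^ (1 - p)` of `perturbation α`, at `0`. -/
noncomputable def reducedTimeTaylor (p α : ℝ) : ℝ :=
  C0 p
    - (p + 1) * α ^ (1 - p) / 2 *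
      (∫ s in (0 : ℝ)..1, perturbation α s / (1 - s ^ (p + 1)) ^ (3 / 2 : ℝ))
    + 3 / 8 * ((p + 1) * α ^ (1 - p)) ^ 2 *
      ∫ s in (0 : ℝ)..1, perturbation α s ^ 2 / (1 - s ^ (p + 1)) ^ (5 / 2 : ℝ)

theorem abs_reducedTime_sub_taylor_le (hp : 1 ≤ p) (hα : 0 ≤ α) :
    |reducedTime p α - reducedTimeTaylor p α|
      ≤ ((p + 1) * α ^ (1 - p) * (1 / 2)) ^ 3 * C0 p := by
  have hmem {P : ℝ → Prop} (h : ∀ s ∈ Ioo (0 : ℝ) 1, P s) :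
      ∀ᵐ s ∂volume.restrict (Ioo (0 : ℝ) 1), P s := ae_restrict_of_forall_mem measurableSet_Ioo h
  simp only [reducedTime, reducedTimeTaylor, C0, intervalIntegral.integral_of_le zero_le_one,
    integral_Ioc_eq_integral_Ioo]
  refine abs_integral_one_div_sqrt_add_sub_le (by fun_prop)
    (continuous_perturbation α).measurable.aemeasurable
    (hmem fun s hs => one_sub_rpow_pos (by linarith) ⟨hs.1.le, hs.2⟩)
    (integrableOn_one_div_sqrt (by linarith))
    (hmem fun s hs => perturbation_nonneg α (Ioo_subset_Icc_self hs)) (hmem fun s hs => ?_)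
    (mul_nonneg (by linarith) (Real.rpow_nonneg hα _))
  have hs' := Ioo_subset_Icc_self hs
  linarith [perturbation_le α hs', one_sub_sq_le_one_sub_rpow (by linarith : 2 ≤ p + 1) hs']

theorem tendsto_integral_perturbation_sq_div (hp : 1 ≤ p) :
    Tendsto (fun α => 3 / 8 * (p + 1) ^ 2 * ∫ s in (0 : ℝ)..1,
      perturbation α s ^ 2 / (1 - s ^ (p + 1)) ^ (5 / 2 : ℝ)) atTop (𝓝 (C2 p)) := by
  have hC2 : C2 p = 3 / 8 * (p + 1) ^ 2 * ∫ s in (0 : ℝ)..1,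
      ((1 - s ^ 2) / 4) ^ 2 / (1 - s ^ (p + 1)) ^ (5 / 2 : ℝ) := by
    simp only [C2, div_pow, div_right_comm _ ((4 : ℝ) ^ 2), intervalIntegral.integral_div]
    ring
  rw [hC2]
  refine Tendsto.const_mul _ ?_
  simp only [intervalIntegral.integral_of_le zero_le_one, integral_Ioc_eq_integral_Ioo]
  refine tendsto_integral_filter_of_dominated_convergence
    (fun s => 1 / 4 * (1 / √(1 - s ^ (p + 1))))
    (Eventually.of_forall fun α => ?_) (Eventually.of_forall fun α => ?_)
    ((integrableOn_one_div_sqrt (by linarith)).const_mul _)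
    (Eventually.of_forall fun s => ((tendsto_perturbation s).pow 2).div_const _)
  · have := (continuous_perturbation α).measurable
    exact Measurable.aestronglyMeasurable (by fun_prop)
  · refine ae_restrict_of_forall_mem measurableSet_Ioo fun s hs => ?_
    have hs' := Ioo_subset_Icc_self hs
    refine abs_div_rpow_le (one_sub_rpow_pos (by linarith) ⟨hs.1.le, hs.2⟩) ?_
    rw [(by norm_num : (5 / 2 - 1 / 2 : ℝ) = 2), Real.rpow_two, abs_of_nonneg (sq_nonneg _)]
    calc perturbation α s ^ 2 ≤ ((1 - s ^ (p + 1)) / 2) ^ 2 :=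
          pow_le_pow_left₀ (perturbation_nonneg α hs') (by
            linarith [perturbation_le α hs',
              one_sub_sq_le_one_sub_rpow (by linarith : 2 ≤ p + 1) hs']) 2
      _ = 1 / 4 * (1 - s ^ (p + 1)) ^ 2 := by ring

theorem isLittleO_rpow_rpow_atTop {a b : ℝ} (hab : a < b) :
    (fun x : ℝ => x ^ a) =o[atTop] fun x => x ^ b := by
  refine isLittleO_of_tendsto'
    ((eventually_gt_atTop 0).mono fun x hx h => absurd h (Real.rpow_pos_of_pos hx b).ne')
    ((tendsto_rpow_neg_atTop (sub_pos.2 hab)).congr' ?_)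
  filter_upwards [eventually_gt_atTop 0] with x hx
  rw [neg_sub, Real.rpow_sub hx]

/-- The expansion of `reducedTime` as `α → ∞`, up to an error `o(α ^ (-p) + α ^ (2 * (1 - p)))`.
Its last two terms compare differently according as `p < 2`, `p = 2` or `p > 2`. -/
noncomputable def reducedTimeExpansion (p α : ℝ) : ℝ :=
  C0 p + (C1 p + 1 / 2 * C11 p α) * α ^ (1 - p)
    + (1 / 2 * C12 p α + 1 / 2 * C21 p α) * α ^ (-p)
    + (C2 p + C3 p α) * α ^ (2 * (1 - p))

theorem reducedTimeTaylor_eq (hp : 0 ≤ p) (hα : 0 < α) :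
    reducedTimeTaylor p α = reducedTimeExpansion p α
        + (p - 1) / 16 * (∫ s in (0 : ℝ)..1,
          (cos (2 * α) - cos (2 * α * s)) / √(1 - s ^ (p + 1))) * α ^ (-p - 1)
        + (3 / 8 * (p + 1) ^ 2 * (∫ s in (0 : ℝ)..1,
          perturbation α s ^ 2 / (1 - s ^ (p + 1)) ^ (5 / 2 : ℝ)) - C2 p - C3 p α)
          * α ^ (2 * (1 - p)) := by
  have hsq : α ^ (2 * (1 - p)) = (α ^ (1 - p)) ^ 2 := by
    rw [mul_comm, Real.rpow_mul hα.le, Real.rpow_two]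
  have hneg : α ^ (1 - p) = α ^ (-p) * α := by
    rw [← Real.rpow_add_one hα.ne', neg_add_eq_sub]
  have hneg' : α ^ (-p - 1) = α ^ (-p) / α := Real.rpow_sub_one hα.ne' _
  have hfirst := integral_perturbation_div hp hα.ne'
  rw [reducedTimeTaylor, reducedTimeExpansion, hsq, hneg', hneg]
  field_simp at hfirst ⊢
  linear_combination (-8) * α ^ (-p) * hfirst

theorem isLittleO_reducedTime_sub_taylor (hp : 1 < p) :
    (fun α => reducedTime p α - reducedTimeTaylor p α) =o[atTop] fun α => α ^ (2 * (1 - p)) := by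
  refine (IsBigO.of_bound (((p + 1) * (1 / 2)) ^ 3 * C0 p) ?_).trans_isLittleO
    (isLittleO_rpow_rpow_atTop (by linarith : 3 * (1 - p) < 2 * (1 - p)))
  filter_upwards [eventually_gt_atTop 0] with α hα
  refine (abs_reducedTime_sub_taylor_le hp.le hα.le).trans_eq ?_
  rw [Real.norm_of_nonneg (by positivity), mul_comm 3, Real.rpow_mul hα.le, Real.rpow_ofNat]
  ring

theorem isLittleO_reducedTime_sub_expansion (hp : 1 < p) :
    (fun α => reducedTime p α - reducedTimeExpansion p α) =o[atTop]
      fun α => α ^ (-p) + α ^ (2 * (1 - p)) := by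
  have hboundary : (fun α => (p - 1) / 16 * (∫ s in (0 : ℝ)..1,
      (cos (2 * α) - cos (2 * α * s)) / √(1 - s ^ (p + 1))) * α ^ (-p - 1))
      =o[atTop] fun α => α ^ (-p) := by
    have h := ((isBigO_one_integral_sub_div_sqrt (l := atTop) (by linarith : 1 ≤ p + 1)
      abs_cos_le_one).const_mul_left ((p - 1) / 16)).mul_isLittleO
      (isLittleO_rpow_rpow_atTop (by linarith : -p - 1 < -p))
    simpa only [one_mul] using h
  have hsecond : (fun α => (3 / 8 * (p + 1) ^ 2 * (∫ s in (0 : ℝ)..1,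
      perturbation α s ^ 2 / (1 - s ^ (p + 1)) ^ (5 / 2 : ℝ)) - C2 p - C3 p α)
        * α ^ (2 * (1 - p))) =o[atTop] fun α => α ^ (2 * (1 - p)) := by
    have hlim := ((tendsto_integral_perturbation_sq_div hp.le).sub_const (C2 p)).sub
      (tendsto_C3 hp.le)
    rw [sub_self, sub_zero] at hlim
    simpa only [one_mul] using ((isLittleO_one_iff ℝ).2 hlim).mul_isBigO (isBigO_refl _ _)
  refine (hboundary.add_add ((isLittleO_reducedTime_sub_taylor hp).add hsecond)).congr' ?_ ?_
  all_goals filter_upwards [eventually_gt_atTop 0] with α hα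
  · rw [reducedTimeTaylor_eq (by linarith) hα]
    ring
  · rw [Real.norm_of_nonneg (by positivity), Real.norm_of_nonneg (by positivity)]

end Remainder

end OscBif

theorem theorem1p4_general (p : ℝ) (hp : 1 < p) :
    (∀ α : ℝ, 0 < α → ∃! m : ℝ, OscBif.IsBifurcationValue p α m) ∧
    ∀ μ : ℝ → ℝ, (∀ α : ℝ, 0 < α → OscBif.IsBifurcationValue p α (μ α)) →
      ∃ r : ℝ → ℝ, r =o[atTop] (fun α : ℝ => α ^ (-p) + α ^ (2 * (1 - p))) ∧
        ∀ α : ℝ, 0 < α → μ α = 2 * (p + 1) * α ^ (1 - p) *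
          (OscBif.C0 p + (OscBif.C1 p + 1 / 2 * OscBif.C11 p α) * α ^ (1 - p)
            + (1 / 2 * OscBif.C12 p α + 1 / 2 * OscBif.C21 p α) * α ^ (-p)
            + (OscBif.C2 p + OscBif.C3 p α) * α ^ (2 * (1 - p)) + r α) ^ 2 := by
  refine ⟨fun α => OscBif.existsUnique_isBifurcationValue hp.le, fun μ hμ =>
    ⟨_, OscBif.isLittleO_reducedTime_sub_expansion hp, fun α hα => ?_⟩⟩
  rw [← OscBif.reducedTimeExpansion, add_sub_cancel]
  exact (hμ α hα).eq_reducedTime_sq (by linarith) hα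

theorem OscBif.bifurcationValue_expansion_of_lt_two {p : ℝ} (hp : 1 < p) (hp2 : p < 2)
    {μ : ℝ → ℝ} (hμ : ∀ α : ℝ, 0 < α → IsBifurcationValue p α (μ α)) :
    ∃ r : ℝ → ℝ, r =o[atTop] (fun α : ℝ => α ^ (2 * (1 - p))) ∧
      ∀ᶠ α : ℝ in atTop, μ α = 2 * (p + 1) * α ^ (1 - p) *
        (C0 p + (C1 p + 1 / 2 * C11 p α) * α ^ (1 - p)
          + (C2 p + C3 p α) * α ^ (2 * (1 - p)) + r α) ^ 2 := by
  obtain ⟨r, hr, hexp⟩ := (theorem1p4_general p hp).2 μ hμ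
  have hscale : (fun α : ℝ => α ^ (-p)) =o[atTop] fun α => α ^ (2 * (1 - p)) :=
    isLittleO_rpow_rpow_atTop (by linarith)
  have hbdd : (fun α => 1 / 2 * C12 p α + 1 / 2 * C21 p α) =O[atTop] fun _ => (1 : ℝ) :=
    ((isBigO_one_C12 (by linarith)).const_mul_left _).add
      ((isBigO_one_C21 (by linarith)).const_mul_left _)
  have habsorb : (fun α => (1 / 2 * C12 p α + 1 / 2 * C21 p α) * α ^ (-p))
      =o[atTop] fun α => α ^ (2 * (1 - p)) := by
    simpa only [one_mul] using hbdd.mul_isLittleO hscale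
  refine ⟨_, habsorb.add (hr.trans_isBigO (hscale.isBigO.add (isBigO_refl _ _))), ?_⟩
  filter_upwards [eventually_gt_atTop 0] with α hα
  rw [hexp α hα]
  ring

theorem OscBif.bifurcationValue_expansion_two
    {μ : ℝ → ℝ} (hμ : ∀ α : ℝ, 0 < α → IsBifurcationValue 2 α (μ α)) :
    ∃ r : ℝ → ℝ, r =o[atTop] (fun α : ℝ => α ^ (-2 : ℝ)) ∧
      ∀ᶠ α : ℝ in atTop, μ α = 6 * α ^ (-1 : ℝ) *
        (C0 2 + (C1 2 + 1 / 2 * C11 2 α) * α ^ (-1 : ℝ)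
          + (1 / 2 * C12 2 α + 1 / 2 * C21 2 α + C2 2 + C3 2 α) * α ^ (-2 : ℝ) + r α) ^ 2 := by
  obtain ⟨r, hr, hexp⟩ := (theorem1p4_general 2 one_lt_two).2 μ hμ
  have hfirst : (1 - 2 : ℝ) = -1 := by norm_num
  have hsecond : (2 * -1 : ℝ) = -2 := by norm_num
  simp only [hfirst, hsecond] at hr hexp
  refine ⟨r, hr.trans_isBigO ((isBigO_refl _ _).add (isBigO_refl _ _)), ?_⟩
  filter_upwards [eventually_gt_atTop 0] with α hα
  rw [hexp α hα]
  ring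

theorem theorem1p4 (p : ℝ) (hp : 1 < p) (hp2 : p ≤ 2) :
    (∀ α : ℝ, 0 < α → ∃! m : ℝ, OscBif.IsBifurcationValue p α m) ∧
    ∀ μ : ℝ → ℝ, (∀ α : ℝ, 0 < α → OscBif.IsBifurcationValue p α (μ α)) →
      (p < 2 → ∃ r : ℝ → ℝ, r =o[atTop] (fun α : ℝ => α ^ (2 * (1 - p))) ∧
        ∀ᶠ α : ℝ in atTop,
          μ α = 2 * (p + 1) * α ^ (1 - p) *
            (OscBif.C0 p + (OscBif.C1 p + 1 / 2 * OscBif.C11 p α) * α ^ (1 - p)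
              + (OscBif.C2 p + OscBif.C3 p α) * α ^ (2 * (1 - p)) + r α) ^ 2) ∧
      (p = 2 → ∃ r : ℝ → ℝ, r =o[atTop] (fun α : ℝ => α ^ (-2 : ℝ)) ∧
        ∀ᶠ α : ℝ in atTop,
          μ α = 6 * α ^ (-1 : ℝ) *
            (OscBif.C0 2 + (OscBif.C1 2 + 1 / 2 * OscBif.C11 2 α) * α ^ (-1 : ℝ)
              + (1 / 2 * OscBif.C12 2 α + 1 / 2 * OscBif.C21 2 α
                  + OscBif.C2 2 + OscBif.C3 2 α) * α ^ (-2 : ℝ) + r α) ^ 2) :=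
  ⟨(theorem1p4_general p hp).1, fun _ hμ =>
    ⟨fun hlt => OscBif.bifurcationValue_expansion_of_lt_two hp hlt hμ, by
      rintro rfl
      exact OscBif.bifurcationValue_expansion_two hμ⟩⟩
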